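/- Let $S$ be a finite set, let $\mathbf P=(p_{ij};\,i,j\in S)$ be a (possibly reducible) stochastic matrix, and let $R\subseteq S$. A forest $\mathbf f$ on $S$ is a directed graph with vertex set $S$ in which every vertex has at most one outgoing edge and which has no directed cycle; $\mathrm{ROOTS}(\mathbf f)$ is the set of vertices without outgoing edge. Put $$\Pi^{\mathbf P}(\mathbf f):=\prod_{i\to j\in\mathbf f}p_{ij},\qquad w(R):=\sum_{\mathrm{ROOTS}(\mathbf f)=R}\Pi^{\mathbf P}(\mathbf f).$$ The loop erasure $(u_0,\dots,u_m)$ of a finite path $(x_0,\dots,x_l)$ is defined by $u_0:=x_0$ and, as long as $u_k\ne x_l$, letting $u_{k+1}$ be the first vertex after the last visit of the path to $u_k$. Wilson's algorithm with root set $R$ runs in stages. In each stage, a new copy of the Markov chain with transition matrix $\mathbf P$ is started at an arbitrary state not on the paths produced in the earlier stages (the choice may depend on everything that happened in the earlier stages and on extra randomization; given all this and the starting state, the new copy is a Markov chain with transition matrix $\mathbf P$). It is run until it first hits $R$ or one of the paths produced earlier, and the loop erasure of its trajectory up to that time is added to the growing forest. The algorithm terminates when the forest spans $S$, that is, when every state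 of $S\setminus R$ lies on one of the produced paths; it then outputs the graph formed by all edges of these paths. Then, whatever rule is used to choose the starting states, the algorithm terminates in finite time almost surely if and only if $w(R)>0$. In that case, for each forest $\mathbf f$ with $\mathrm{ROOTS}(\mathbf f)=R$, the algorithm outputs $\mathbf f$ with probability $\Pi^{\mathbf P}(\mathbf f)/w(R)$. -/

import Mathlib

open MeasureTheory

namespace WilsonForest

section Forests

variable {S : Type*} [Fintype S] [DecidableEq S]

/-- A directed graph on `S` is the finite set of its directed edges `i → j`. Its weight is the
product of `P i j` over its edges. -/
def weight (P : Matrix S S ℝ) (g : Finset (S × S)) : ℝ :=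
  ∏ e ∈ g, P e.1 e.2

/-- A forest with vertex set `S` and edges directed towards the roots: every vertex has at most
one outgoing edge, and there is no directed cycle (in particular no edge `i → i`). -/
def IsForest (f : Finset (S × S)) : Prop :=
  (∀ i j k, (i, j) ∈ f → (i, k) ∈ f → j = k) ∧
    ∀ i, ¬ Relation.TransGen (fun a b => (a, b) ∈ f) i i

/-- The roots of a forest are the vertices without outgoing edge (isolated vertices included). -/
def roots (f : Finset (S × S)) : Finset S :=
  Finset.univ.filter fun i => ∀ j, (i, j) ∉ f

open Classical in
/-- `w(R)`: the total weight of all forests labeled by `S` whose set of roots is `R`. -/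
noncomputable def w (P : Matrix S S ℝ) (R : Finset S) : ℝ :=
  ∑ f ∈ Finset.univ.filter (fun f : Finset (S × S) => IsForest f ∧ roots f = R), weight P f

end Forests

section Algorithm

variable {S : Type*} [DecidableEq S]

/-- Chronological loop erasure of a finite path `x₀, x₁, …, x_l`: keep `u₀ = x₀`, discard
everything up to and including the last visit to `x₀`, and go on in the same way with the
remaining path (whose first vertex is `u₁`). `xs.rtakeWhile (· ≠ x)` is the part of `xs` after the
last visit to `x`; it is all of `xs` if `x` does not occur in `xs`. -/
def loopErasure : List S → List S
  | [] => []
  | x :: xs => x :: loopErasure (xs.rtakeWhile (fun y => y ≠ x))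
termination_by l => l.length
decreasing_by
  exact Nat.lt_succ_of_le (List.IsSuffix.length_le (List.rtakeWhile_suffix _ _))

/-- The directed edges `u₀ → u₁ → ⋯ → u_m` of a path. -/
def pathEdges (u : List S) : Finset (S × S) :=
  (u.zip u.tail).toFinset

/-- What has been built so far: the edges of the growing forest, and the set of all vertices of
the paths produced by the previous stages. -/
structure Config (S : Type*) where
  edges : Finset (S × S)
  visited : Finset S

open Classical in
/-- One stage of the algorithm with root set `R`, using the infinite trajectory `x` of the copy of
the chain run in this stage: run it until it first hits `R` or a path built before, and add the
loop erasure of the trajectory up to that time. The value `none` means that the walk never hits, so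
that the stage does not end. -/
noncomputable def stage (R : Finset S) (x : ℕ → S) (c : Config S) : Option (Config S) :=
  if h : ∃ n, x n ∈ R ∪ c.visited then
    let u := loopErasure ((List.range (Nat.find h + 1)).map x)
    some ⟨c.edges ∪ pathEdges u, c.visited ∪ u.toFinset⟩
  else none

variable [Fintype S]

/-- The growing forest spans `S`; the algorithm then stops. -/
def Config.Spans (R : Finset S) (c : Config S) : Prop :=
  R ∪ c.visited = Finset.univ

open Classical in
/-- The configuration after `k` stages, if stage `k` uses the trajectory `n ↦ x k n`; `none` if one
of these stages does not end. Once the forest spans `S` nothing changes any more. -/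
noncomputable def config (R : Finset S) (x : ℕ → ℕ → S) : ℕ → Option (Config S)
  | 0 => some ⟨∅, ∅⟩
  | k + 1 => (config R x k).bind fun c => if c.Spans R then some c else stage R (x k) c

/-- The algorithm terminates in finite time. -/
def Terminates (R : Finset S) (x : ℕ → ℕ → S) : Prop :=
  ∃ k c, config R x k = some c ∧ c.Spans R

/-- The algorithm terminates in finite time and generates `f`. -/
def Generates (R : Finset S) (x : ℕ → ℕ → S) (f : Finset (S × S)) : Prop :=
  ∃ k c, config R x k = some c ∧ c.Spans R ∧ c.edges = f

end Algorithm

section Randomness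

variable {S Ω : Type*}

/-- Conditionally on the σ-algebra `m`, the process `X` is a Markov chain with transition matrix `P`
and initial state `X 0` (which is `m`-measurable in all uses below). -/
def IsChainGiven [mΩ : MeasurableSpace Ω] (P : Matrix S S ℝ) (μ : Measure Ω)
    (m : MeasurableSpace Ω) (X : ℕ → Ω → S) : Prop :=
  ∀ A, MeasurableSet[m] A → ∀ (n : ℕ) (x : ℕ → S),
    μ (A ∩ {ω | ∀ k ≤ n, X k ω = x k}) =
      μ (A ∩ {ω | X 0 ω = x 0}) * ∏ k ∈ Finset.range n, ENNReal.ofReal (P (x k) (x (k + 1)))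

/-- The random input of Wilson's algorithm with root set `R`: `X k n` is the state at time `n` of
the copy of the chain that is run in stage `k`, and `ℱ k` is the information available when stage
`k` begins. The start `X k 0` is any state outside the previously built paths, chosen by an
arbitrary rule that may use everything in `ℱ k` (all earlier walks and any extra randomization);
given `ℱ k`, the walk `X k` is a copy of the chain started there. -/
structure IsWilsonInput [Fintype S] [DecidableEq S] [mΩ : MeasurableSpace Ω] (P : Matrix S S ℝ)
    (R : Finset S) (μ : Measure Ω) (ℱ : Filtration ℕ mΩ) (X : ℕ → ℕ → Ω → S) : Prop where
  measurable_start : ∀ k s, MeasurableSet[ℱ k] {ω | X k 0 ω = s}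
  measurable_walk : ∀ k n s, MeasurableSet[ℱ (k + 1)] {ω | X k n ω = s}
  chain : ∀ k, IsChainGiven P μ (ℱ k) (X k)
  start_new : ∀ k, ∀ᵐ ω ∂μ, ∀ c, config R (fun j n => X j n ω) k = some c → ¬ c.Spans R →
    X k 0 ω ∉ c.visited

end Randomness

end WilsonForest

/-! Write `D(T)` for `(absorb P T).det`, the principal minor of `1 - P` on the complement of `T`.
The heart of the proof is the law of one stage (`det_absorb_mul_hitReal_loopErasure`): for the chain
started at the first vertex of a self-avoiding path `u` that stops at `T`, `D(T)` times the
probability that the loop erasure at the hitting time of `T` is `u` equals the weight of `u` times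
`D(T ∪ u)`. It is obtained vertex by vertex, by decomposing at the last visit to the first vertex
and applying Cramer's rule.

To generate a given forest `f`, each stage must produce the path of `f` from its starting state to
what is already built, whatever rule chose that state. The determinants therefore telescope down to
`D(S) = 1`, and `D(R)` times the probability of `f` is the weight of `f` (`measure_generates`),
independently of the rule.

If `w(R) > 0`, some forest rooted at `R` has only edges of positive probability. A maximum principle
along this forest gives `D(T) ≠ 0` and almost sure hitting of `T` for all `T ⊇ R`, so every stage
ends. The output probabilities then sum to one, which forces `D(R) = w(R)`: this determinantal
formula is a by-product and is not assumed. Conversely, any terminating run whose walks make only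
steps of positive probability outputs a forest of positive weight. -/

namespace WilsonForest

/-! ### Stopped paths, loop erasure and edge sets -/

section Paths

variable {S : Type*}

/-- `StopsAt T l`: the last vertex of `l` lies in `T`, and no earlier one does. -/
inductive StopsAt (T : Finset S) : List S → Prop
  | single {x : S} (hx : x ∈ T) : StopsAt T [x]
  | cons {x : S} {l : List S} (hx : x ∉ T) (hl : StopsAt T l) : StopsAt T (x :: l)

namespace StopsAt

variable {T : Finset S} {l : List S} {x : S}

theorem ne_nil (h : StopsAt T l) : l ≠ [] := by
  cases h <;> simp

theorem of_cons (h : StopsAt T (x :: l)) (hl : l ≠ []) : x ∉ T ∧ StopsAt T l := by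
  cases h with
  | single => exact absurd rfl hl
  | cons hx h => exact ⟨hx, h⟩

theorem of_suffix {l' : List S} (h : StopsAt T l) (hs : l' <:+ l) (hl : l' ≠ []) :
    StopsAt T l' := by
  induction h with
  | single hx =>
    rcases List.suffix_cons_iff.1 hs with rfl | hs
    · exact .single hx
    · exact absurd (List.suffix_nil.1 hs) hl
  | cons hx h ih =>
    rcases List.suffix_cons_iff.1 hs with rfl | hs
    · exact .cons hx h
    · exact ih hs

theorem insert [DecidableEq S] {a : S} (h : StopsAt T l) (ha : a ∉ l) :
    StopsAt (insert a T) l := by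
  induction h with
  | single hx => exact .single (Finset.mem_insert_of_mem hx)
  | cons hx h ih =>
    simp only [List.mem_cons, not_or] at ha
    exact .cons (by simp [hx, Ne.symm ha.1]) (ih ha.2)

theorem getLast?_eq_of_mem (h : StopsAt T l) (hx : x ∈ l) (hT : x ∈ T) : l.getLast? = some x := by
  induction h with
  | single h => simp_all
  | cons hy h ih =>
    rcases List.mem_cons.1 hx with rfl | hx
    · exact absurd hT hy
    · rw [List.getLast?_cons, ih hx]; rfl

theorem map_range {x : ℕ → S} {n : ℕ} (hn : x n ∈ T) (h : ∀ m < n, x m ∉ T) :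
    StopsAt T ((List.range (n + 1)).map x) := by
  induction n generalizing x with
  | zero => exact .single hn
  | succ n ih =>
    rw [List.range_succ_eq_map, List.map_cons, List.map_map]
    exact .cons (h 0 (by omega)) (ih (x := x ∘ Nat.succ) hn fun m hm => h _ (by simpa using hm))

/-- A path of a graph with at most one outgoing edge per vertex is determined by its first vertex
and the set where it stops. -/
theorem unique {r : S → S → Prop} (hr : ∀ i j k, r i j → r i k → j = k) {u v : List S}
    (hu : StopsAt T u) (hv : StopsAt T v) (cu : u.IsChain r) (cv : v.IsChain r)
    (huv : u.head? = v.head?) : u = v := by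
  induction hu generalizing v with
  | single hx =>
    cases hv with
    | single hy => simpa using huv
    | cons hy hv => simp_all
  | @cons x l hx hl ih =>
    cases hv with
    | single hy => simp_all
    | @cons y l' hy hv =>
      obtain rfl : x = y := by simpa using huv
      obtain ⟨b, l, rfl⟩ := List.exists_cons_of_ne_nil hl.ne_nil
      obtain ⟨c, l', rfl⟩ := List.exists_cons_of_ne_nil hv.ne_nil
      rw [List.isChain_cons_cons] at cu cv
      rw [ih hv cu.2 cv.2 (by simp [hr _ _ _ cu.1 cv.1])]

end StopsAt

section LoopErasure

variable [DecidableEq S]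

/-- Restarting at the last visit to `x` leaves a genuine final segment of the path, so stopping and
chain properties pass to it. -/
theorem cons_rtakeWhile_ne_suffix (x : S) (l : List S) :
    x :: l.rtakeWhile (fun y => y ≠ x) <:+ x :: l := by
  induction l using List.reverseRecOn with
  | nil => simp
  | append_singleton l a ih =>
    rw [List.rtakeWhile_concat]
    split_ifs with h
    · obtain ⟨t, ht⟩ := ih
      exact ⟨t, by rw [← List.cons_append, ← List.append_assoc, ht, List.cons_append]⟩
    · obtain rfl : a = x := by simpa using h
      exact ⟨a :: l, by simp⟩

theorem notMem_rtakeWhile_ne (x : S) (l : List S) : x ∉ l.rtakeWhile (fun y => y ≠ x) := by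
  intro h
  simpa using List.mem_rtakeWhile_imp h

theorem rtakeWhile_ne_cons_self (x : S) (l : List S) :
    (x :: l).rtakeWhile (fun y => y ≠ x) = l.rtakeWhile (fun y => y ≠ x) := by
  induction l using List.reverseRecOn with
  | nil => simp [List.rtakeWhile]
  | append_singleton l a ih =>
    rw [← List.cons_append, List.rtakeWhile_concat, List.rtakeWhile_concat, ih]

/-- An extra first step cannot affect what follows a later last visit; this is what makes the
function `v` of `det_absorb_mul_hitReal_cons` harmonic away from `a`. -/
theorem rtakeWhile_ne_cons_of_mem {x : S} (y : S) {l : List S} (h : x ∈ l) :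
    (y :: l).rtakeWhile (fun z => z ≠ x) = l.rtakeWhile (fun z => z ≠ x) := by
  induction l using List.reverseRecOn with
  | nil => simp at h
  | append_singleton l a ih =>
    rw [← List.cons_append, List.rtakeWhile_concat, List.rtakeWhile_concat]
    split_ifs with ha
    · rw [ih]
      simp only [List.mem_append, List.mem_singleton] at h
      exact h.resolve_right fun e => by simp [e] at ha
    · rfl

theorem rtakeWhile_ne_of_notMem {x : S} {l : List S} (h : x ∉ l) :
    l.rtakeWhile (fun z => z ≠ x) = l := by
  rw [List.rtakeWhile_eq_self_iff]
  intro y hy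
  simp only [ne_eq, decide_not, Bool.not_eq_eq_eq_not, Bool.not_true, decide_eq_false_iff_not]
  rintro rfl
  exact h hy

@[simp] theorem loopErasure_nil : loopErasure ([] : List S) = [] := by
  rw [loopErasure]

theorem loopErasure_cons (x : S) (l : List S) :
    loopErasure (x :: l) = x :: loopErasure (l.rtakeWhile (fun y => y ≠ x)) := by
  rw [loopErasure]

/-- Induction along the loop erasure: a nonempty list may be replaced by its part from the last
visit of the first vertex on. -/
theorem loopErasure_induction {motive : List S → Prop} (nil : motive [])
    (cons : ∀ x l, motive (l.rtakeWhile (fun y => y ≠ x)) → motive (x :: l)) (l : List S) :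
    motive l := by
  induction h : l.length using Nat.strong_induction_on generalizing l with
  | _ n ih =>
    cases l with
    | nil => exact nil
    | cons x l =>
      refine cons x l (ih _ ?_ _ rfl)
      rw [← h]
      exact Nat.lt_succ_of_le (List.rtakeWhile_suffix _ _).length_le

@[simp] theorem head?_loopErasure (l : List S) : (loopErasure l).head? = l.head? := by
  cases l <;> simp [loopErasure_cons]

theorem getLast?_loopErasure (l : List S) : (loopErasure l).getLast? = l.getLast? := by
  induction l using loopErasure_induction with
  | nil => simp
  | cons x l ih =>
    obtain ⟨t, ht⟩ := cons_rtakeWhile_ne_suffix x l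
    rw [loopErasure_cons, List.getLast?_cons, ih, ← List.getLast?_cons, ← ht]
    simp [List.getLast?_append, List.getLast?_cons]

theorem loopErasure_subset (l : List S) : loopErasure l ⊆ l := by
  induction l using loopErasure_induction with
  | nil => simp
  | cons x l ih =>
    rw [loopErasure_cons]
    exact List.cons_subset_cons x (List.Subset.trans ih (List.rtakeWhile_suffix _ _).subset)

theorem nodup_loopErasure (l : List S) : (loopErasure l).Nodup := by
  induction l using loopErasure_induction with
  | nil => simp
  | cons x l ih =>
    rw [loopErasure_cons, List.nodup_cons]
    exact ⟨fun h => notMem_rtakeWhile_ne x l (loopErasure_subset _ h), ih⟩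

theorem StopsAt.loopErasure {T : Finset S} {l : List S} (h : StopsAt T l) :
    StopsAt T (loopErasure l) := by
  induction l using loopErasure_induction with
  | nil => simpa using h
  | cons x l ih =>
    have h' := h.of_suffix (cons_rtakeWhile_ne_suffix x l) (by simp)
    rw [loopErasure_cons]
    by_cases hl : l.rtakeWhile (fun y => y ≠ x) = []
    · rw [hl] at h' ⊢
      simpa using h'
    · exact .cons (h'.of_cons hl).1 (ih (h'.of_cons hl).2)

theorem isChain_loopErasure {r : S → S → Prop} {l : List S} (h : l.IsChain r) :
    (loopErasure l).IsChain r := by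
  induction l using loopErasure_induction with
  | nil => simp
  | cons x l ih =>
    have h' := h.suffix (cons_rtakeWhile_ne_suffix x l)
    rw [List.isChain_cons] at h'
    rw [loopErasure_cons, List.isChain_cons, head?_loopErasure]
    exact ⟨h'.1, ih h'.2⟩

end LoopErasure

section PathEdges

variable [DecidableEq S]

@[simp] theorem pathEdges_singleton (a : S) : pathEdges [a] = ∅ := rfl

@[simp] theorem pathEdges_cons_cons (a b : S) (l : List S) :
    pathEdges (a :: b :: l) = insert (a, b) (pathEdges (b :: l)) := by
  simp [pathEdges]

theorem isChain_pathEdges (u : List S) : u.IsChain fun i j => (i, j) ∈ pathEdges u := by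
  induction u with
  | nil => simp
  | cons a l ih =>
    cases l with
    | nil => simp
    | cons b l =>
      rw [List.isChain_cons_cons]
      exact ⟨by simp, ih.imp fun i j h => by simp [h]⟩

theorem rel_of_mem_pathEdges {r : S → S → Prop} {u : List S} (h : u.IsChain r) {e : S × S}
    (he : e ∈ pathEdges u) : r e.1 e.2 := by
  induction u with
  | nil => simp [pathEdges] at he
  | cons a l ih =>
    cases l with
    | nil => simp at he
    | cons b l =>
      rw [List.isChain_cons_cons] at h
      rw [pathEdges_cons_cons, Finset.mem_insert] at he
      rcases he with rfl | he
      · exact h.1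
      · exact ih h.2 he

theorem fst_mem_of_mem_pathEdges {u : List S} {e : S × S} (he : e ∈ pathEdges u) : e.1 ∈ u :=
  (List.of_mem_zip (List.mem_toFinset.1 he : (e.1, e.2) ∈ _)).1

theorem StopsAt.fst_notMem {T : Finset S} {u : List S} (h : StopsAt T u) {e : S × S}
    (he : e ∈ pathEdges u) : e.1 ∉ T := by
  induction h with
  | single => simp at he
  | cons hx hl ih =>
    obtain ⟨b, l, rfl⟩ := List.exists_cons_of_ne_nil hl.ne_nil
    rw [pathEdges_cons_cons, Finset.mem_insert] at he
    rcases he with rfl | he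
    · exact hx
    · exact ih he

theorem StopsAt.exists_mem_pathEdges {T : Finset S} {u : List S} (h : StopsAt T u) {x : S}
    (hx : x ∈ u) (hT : x ∉ T) : ∃ y, (x, y) ∈ pathEdges u := by
  induction h with
  | single hy => simp_all
  | cons hy hl ih =>
    obtain ⟨b, l, rfl⟩ := List.exists_cons_of_ne_nil hl.ne_nil
    rcases List.mem_cons.1 hx with rfl | hx
    · exact ⟨b, by simp⟩
    · obtain ⟨y, hy⟩ := ih hx
      exact ⟨y, by simp [hy]⟩

theorem weight_pathEdges_cons_cons (P : Matrix S S ℝ) {a b : S} {l : List S}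
    (h : a ∉ b :: l) : weight P (pathEdges (a :: b :: l)) = P a b * weight P (pathEdges (b :: l)) := by
  rw [pathEdges_cons_cons, weight, weight, Finset.prod_insert]
  exact fun he => h (fst_mem_of_mem_pathEdges he)

end PathEdges

end Paths

/-! ### Forests and partially built forests -/

section Forests

variable {S : Type*} {f : Finset (S × S)}

/-- The successor of a vertex counts as smaller, so induction and minimal elements go towards the
roots. -/
theorem IsForest.wellFounded [Finite S] (hf : IsForest f) : WellFounded fun b a => (a, b) ∈ f := by
  let q : S → S → Prop := fun b a => Relation.TransGen (fun a b => (a, b) ∈ f) a b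
  have : IsTrans S q := ⟨fun _ _ _ h h' => Relation.TransGen.trans h' h⟩
  have : Std.Irrefl q := ⟨hf.2⟩
  have : WellFounded q := Finite.wellFounded_of_trans_of_irrefl q
  exact Subrelation.wf (fun h => Relation.TransGen.single h) this

theorem IsForest.nodup (hf : IsForest f) {u : List S} (hu : u.IsChain fun i j => (i, j) ∈ f) :
    u.Nodup := by
  have h : u.IsChain (Relation.TransGen fun i j => (i, j) ∈ f) := hu.imp fun _ _ => .single
  have : IsTrans S (Relation.TransGen fun i j => (i, j) ∈ f) := ⟨fun _ _ _ => .trans⟩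
  rw [List.isChain_iff_pairwise] at h
  exact h.imp fun {a b} hab => by rintro rfl; exact hf.2 _ hab

theorem isForest_of_rank (h1 : ∀ i j k, (i, j) ∈ f → (i, k) ∈ f → j = k) (r : S → ℕ)
    (hr : ∀ i j, (i, j) ∈ f → r j < r i) : IsForest f := by
  refine ⟨h1, fun i hi => ?_⟩
  have : ∀ {a b}, Relation.TransGen (fun a b => (a, b) ∈ f) a b → r b < r a := by
    intro a b hab
    induction hab with
    | single h => exact hr _ _ h
    | tail _ h ih => exact (hr _ _ h).trans ih
  exact lt_irrefl _ (this hi)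

/-- A configuration of the algorithm with root set `R`: a graph with at most one edge out of each
vertex, whose edges lead from the visited vertices outside `R` to visited vertices, and which is
acyclic since some rank function decreases along the edges. -/
structure Config.Good (R : Finset S) (c : Config S) : Prop where
  unique : ∀ i j k, (i, j) ∈ c.edges → (i, k) ∈ c.edges → j = k
  source : ∀ i, (∃ j, (i, j) ∈ c.edges) ↔ i ∈ c.visited ∧ i ∉ R
  target : ∀ i j, (i, j) ∈ c.edges → j ∈ c.visited
  rank : ∃ r : S → ℕ, ∀ i j, (i, j) ∈ c.edges → r j < r i

theorem Config.Good.isForest {R : Finset S} {c : Config S} (h : c.Good R) : IsForest c.edges :=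
  let ⟨r, hr⟩ := h.rank
  isForest_of_rank h.unique r hr

variable [DecidableEq S]

/-- Add the path `u` to a configuration. -/
def Config.addPath (c : Config S) (u : List S) : Config S :=
  ⟨c.edges ∪ pathEdges u, c.visited ∪ u.toFinset⟩

/-- The path is attached from its end backwards: each prepended vertex is new, so it is the target
of no edge and acquires exactly one outgoing edge. -/
theorem Config.Good.addPath {R : Finset S} {c : Config S} (h : c.Good R) {u : List S}
    (hu : StopsAt (R ∪ c.visited) u) (hn : u.Nodup) : (c.addPath u).Good R := by
  induction hu with
  | @single x hx =>
    refine ⟨by simpa [Config.addPath] using h.unique, fun i => ?_,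
      fun i j hij => ?_, by simpa [Config.addPath] using h.rank⟩
    · simp only [Config.addPath, pathEdges_singleton, Finset.union_empty, h.source i]
      simp only [List.toFinset_cons, List.toFinset_nil, Finset.mem_union, Finset.mem_insert] at hx ⊢
      grind
    · simp only [Config.addPath, pathEdges_singleton, Finset.union_empty] at hij
      exact Finset.mem_union_left _ (h.target i j hij)
  | @cons x l hx hl ih =>
    obtain ⟨b, l, rfl⟩ := List.exists_cons_of_ne_nil hl.ne_nil
    rw [List.nodup_cons] at hn
    have g := ih hn.2
    have e1 : ∀ i j, (i, j) ∈ (c.addPath (x :: b :: l)).edges ↔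
        (i = x ∧ j = b) ∨ (i, j) ∈ (c.addPath (b :: l)).edges := by
      intro i j
      simp only [Config.addPath, pathEdges_cons_cons, Finset.mem_union, Finset.mem_insert,
        Prod.mk.injEq]
      tauto
    have e2 : ∀ i, i ∈ (c.addPath (x :: b :: l)).visited ↔
        i = x ∨ i ∈ (c.addPath (b :: l)).visited := by
      intro i
      simp only [Config.addPath, List.toFinset_cons, Finset.mem_union, Finset.mem_insert]
      tauto
    have hxR : x ∉ R := fun h => hx (Finset.mem_union_left _ h)
    have hxv : x ∉ (c.addPath (b :: l)).visited := by
      simp only [Config.addPath, Finset.mem_union, List.mem_toFinset, not_or]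
      exact ⟨fun h => hx (Finset.mem_union_right _ h), hn.1⟩
    have hsrc : ∀ j, (x, j) ∉ (c.addPath (b :: l)).edges := fun j hj =>
      hxv ((g.source x).1 ⟨j, hj⟩).1
    have hb : b ∈ (c.addPath (b :: l)).visited := by simp [Config.addPath]
    obtain ⟨r, hr⟩ := g.rank
    refine ⟨fun i j k hj hk => ?_, fun i => ?_, fun i j hij => ?_,
      -- Only the edge `x → b` leaves `x` and none enters it, so its rank may be chosen freely above
      -- that of `b`.
      Function.update r x (r b + 1), fun i j hij => ?_⟩
    · rw [e1] at hj hk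
      have := g.unique i j k
      grind
    · simp only [e1, e2]
      have := g.source i
      grind
    · rw [e1] at hij
      rw [e2]
      have := g.target i j
      grind
    · rw [e1] at hij
      have := g.target i j
      have := hr i j
      have := g.source i
      grind [Function.update_apply]

variable [Fintype S]

theorem exists_edge_of_notMem_roots {i : S} (h : i ∉ roots f) : ∃ j, (i, j) ∈ f := by
  simpa [roots] using h

theorem IsForest.exists_path (hf : IsForest f) {T : Finset S} (hT : roots f ⊆ T) (s : S) :
    ∃ u : List S, u.head? = some s ∧ StopsAt T u ∧ u.IsChain (fun i j => (i, j) ∈ f) := by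
  induction s using hf.wellFounded.induction with
  | _ s ih =>
    by_cases hs : s ∈ T
    · exact ⟨[s], rfl, .single hs, by simp⟩
    · obtain ⟨j, hj⟩ := exists_edge_of_notMem_roots fun h => hs (hT h)
      obtain ⟨u, hu, hsu, cu⟩ := ih j hj
      refine ⟨s :: u, rfl, .cons hs hsu, ?_⟩
      rw [List.isChain_cons]
      refine ⟨fun y hy => ?_, cu⟩
      rw [hu] at hy
      obtain rfl : j = y := by simpa using hy
      exact hj

theorem Config.Good.roots_eq {R : Finset S} {c : Config S} (h : c.Good R) (hs : c.Spans R) :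
    roots c.edges = R := by
  ext i
  have h1 := h.source i
  have h2 : i ∈ R ∪ c.visited := by rw [hs]; simp
  rw [Finset.mem_union] at h2
  rw [roots, Finset.mem_filter, ← not_exists, h1]
  simp
  tauto

end Forests

/-! ### Deterministic analysis of the algorithm -/

section Algorithm

variable {S : Type*} {R : Finset S}

/-- The trajectory `x` first hits `T` at time `n`, and its path up to that time lies in `φ`. -/
def HitsVia (T : Finset S) (n : ℕ) (φ : Set (List S)) (x : ℕ → S) : Prop :=
  x n ∈ T ∧ (∀ m < n, x m ∉ T) ∧ (List.range (n + 1)).map x ∈ φ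

theorem HitsVia.eq {T : Finset S} {n m : ℕ} {φ ψ : Set (List S)} {x : ℕ → S}
    (h : HitsVia T n φ x) (h' : HitsVia T m ψ x) : n = m := by
  rcases lt_trichotomy n m with hl | hl | hl
  · exact absurd h.1 (h'.2.1 n hl)
  · exact hl
  · exact absurd h'.1 (h.2.1 m hl)

theorem hitsVia_zero {T : Finset S} {φ : Set (List S)} {x : ℕ → S} :
    HitsVia T 0 φ x ↔ x 0 ∈ T ∧ [x 0] ∈ φ := by
  simp [HitsVia]

theorem hitsVia_succ {T : Finset S} {n : ℕ} {φ : Set (List S)} {x : ℕ → S} :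
    HitsVia T (n + 1) φ x ↔
      x 0 ∉ T ∧ HitsVia T n {l | x 0 :: l ∈ φ} fun m => x (m + 1) := by
  simp only [HitsVia, Set.mem_ofPred_eq]
  have : (List.range (n + 1 + 1)).map x = x 0 :: (List.range (n + 1)).map fun m => x (m + 1) := by
    rw [List.range_succ_eq_map, List.map_cons, List.map_map]
    rfl
  rw [this]
  constructor
  · rintro ⟨h1, h2, h3⟩
    exact ⟨h2 0 (by omega), h1, fun m hm => h2 _ (by omega), h3⟩
  · rintro ⟨h0, h1, h2, h3⟩
    refine ⟨h1, fun m hm => ?_, h3⟩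
    cases m with
    | zero => exact h0
    | succ m => exact h2 m (by omega)

variable [DecidableEq S]

open Classical in
theorem stage_eq_some_iff {x : ℕ → S} {c c' : Config S} :
    stage R x c = some c' ↔
      ∃ n, HitsVia (R ∪ c.visited) n {l | c.addPath (loopErasure l) = c'} x := by
  unfold stage
  split_ifs with h
  · simp only [Option.some.injEq]
    constructor
    · intro e
      exact ⟨Nat.find h, Nat.find_spec h, fun m hm => Nat.find_min h hm, e⟩
    · rintro ⟨n, h1, h2, h3⟩
      have : Nat.find h = n := (Nat.find_eq_iff h).2 ⟨h1, h2⟩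
      rw [this]
      exact h3
  · simp only [false_iff]
    rintro ⟨n, h1, -⟩
    exact h ⟨n, h1⟩

theorem stage_eq_none_iff {x : ℕ → S} {c : Config S} :
    stage R x c = none ↔ ∀ n, ¬ HitsVia (R ∪ c.visited) n Set.univ x := by
  classical
  unfold stage
  split_ifs with h
  · simp only [false_iff, not_forall, not_not]
    exact ⟨Nat.find h, Nat.find_spec h, fun m hm => Nat.find_min h hm, trivial⟩
  · simp only [true_iff]
    exact fun n hn => h ⟨n, hn.1⟩

theorem exists_addPath_of_stage_eq {x : ℕ → S} {c c' : Config S}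
    (h : stage R x c = some c') :
    ∃ n, HitsVia (R ∪ c.visited) n {l | c.addPath (loopErasure l) = c'} x ∧
      StopsAt (R ∪ c.visited) (loopErasure ((List.range (n + 1)).map x)) ∧
      (loopErasure ((List.range (n + 1)).map x)).head? = some (x 0) := by
  obtain ⟨n, hn⟩ := stage_eq_some_iff.1 h
  refine ⟨n, hn, (StopsAt.map_range hn.1 hn.2.1).loopErasure, ?_⟩
  rw [head?_loopErasure, List.range_succ_eq_map]
  rfl

variable [Fintype S] {x : ℕ → ℕ → S} {c c' : Config S} {k k' : ℕ}

theorem config_succ_of_spans (h : config R x k = some c) (hs : c.Spans R) :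
    config R x (k + 1) = some c := by
  simp [config, h, hs]

theorem config_succ_of_not_spans (h : config R x k = some c) (hs : ¬ c.Spans R) :
    config R x (k + 1) = stage R (x k) c := by
  simp [config, h, hs]

theorem config_of_spans (h : config R x k = some c) (hs : c.Spans R) (hk : k ≤ k') :
    config R x k' = some c := by
  induction hk with
  | refl => exact h
  | step _ ih => exact config_succ_of_spans ih hs

theorem exists_config_of_succ (h : config R x (k + 1) = some c) :
    ∃ c', config R x k = some c' ∧
      ((c'.Spans R ∧ c' = c) ∨ (¬ c'.Spans R ∧ stage R (x k) c' = some c)) := by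
  rw [config, Option.bind_eq_some_iff] at h
  obtain ⟨c', h1, h2⟩ := h
  refine ⟨c', h1, ?_⟩
  split_ifs at h2 with hs
  · exact .inl ⟨hs, by simpa using h2⟩
  · exact .inr ⟨hs, h2⟩

theorem exists_config_of_le (h : config R x k' = some c') (hk : k ≤ k') :
    ∃ c, config R x k = some c ∧ c.edges ⊆ c'.edges := by
  induction hk generalizing c' with
  | refl => exact ⟨c', h, subset_rfl⟩
  | step _ ih =>
    obtain ⟨c1, h1, h2⟩ := exists_config_of_succ h
    obtain ⟨c, hc, hc1⟩ := ih h1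
    refine ⟨c, hc, hc1.trans ?_⟩
    rcases h2 with ⟨-, rfl⟩ | ⟨-, h2⟩
    · rfl
    · obtain ⟨n, hn⟩ := stage_eq_some_iff.1 h2
      rw [← hn.2.2]
      exact Finset.subset_union_left

theorem good_of_config (h : config R x k = some c) : c.Good R := by
  induction k generalizing c with
  | zero =>
    obtain rfl : ⟨∅, ∅⟩ = c := by simpa [config] using h
    exact ⟨by simp, by simp, by simp, fun _ => 0, by simp⟩
  | succ k ih =>
    obtain ⟨c', h1, ⟨-, rfl⟩ | ⟨-, h2⟩⟩ := exists_config_of_succ h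
    · exact ih h1
    · obtain ⟨n, hn, hs, -⟩ := exists_addPath_of_stage_eq h2
      rw [← hn.2.2]
      exact (ih h1).addPath hs (nodup_loopErasure _)

/-- Each stage visits at least its own, previously unvisited, starting state. Vertices are counted
rather than edges because a stage may start in `R` and then adds no edge. -/
theorem spans_or_le_card_of_config
    (hx : ∀ k c, config R x k = some c → ¬ c.Spans R → x k 0 ∉ c.visited)
    (h : config R x k = some c) : c.Spans R ∨ k ≤ c.visited.card := by
  induction k generalizing c with
  | zero => simp
  | succ k ih =>
    obtain ⟨c', h1, ⟨hs, rfl⟩ | ⟨hs, h2⟩⟩ := exists_config_of_succ h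
    · exact .inl hs
    · obtain ⟨n, hn, -, hh⟩ := exists_addPath_of_stage_eq h2
      refine .inr ((Nat.succ_le_succ ((ih h1).resolve_left hs)).trans
        (Finset.card_lt_card ?_))
      rw [← hn.2.2]
      refine Finset.ssubset_iff_subset_ne.2 ⟨Finset.subset_union_left, fun e => hx k c' h1 hs ?_⟩
      rw [e]
      exact Finset.mem_union_right _ (List.mem_toFinset.2 (List.mem_of_mem_head? hh))

theorem terminates_of_config_ne_none
    (hx : ∀ k c, config R x k = some c → ¬ c.Spans R → x k 0 ∉ c.visited)
    (h : ∀ k, config R x k ≠ none) : Terminates R x := by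
  obtain ⟨c, hc⟩ := Option.ne_none_iff_exists'.1 (h (Fintype.card S))
  refine ⟨_, c, hc, (spans_or_le_card_of_config hx hc).elim id fun hle => ?_⟩
  have : c.visited = Finset.univ := by
    rw [← Finset.card_eq_iff_eq_univ]
    exact le_antisymm (Finset.card_le_univ _) hle
  simp [Config.Spans, this]

theorem Terminates.exists_generates (h : Terminates R x) :
    ∃ f, IsForest f ∧ roots f = R ∧ Generates R x f := by
  obtain ⟨k, c, hc, hs⟩ := h
  have g := good_of_config hc
  exact ⟨c.edges, g.isForest, g.roots_eq hs, k, c, hc, hs, rfl⟩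

theorem Generates.unique {f g : Finset (S × S)} (hf : Generates R x f) (hg : Generates R x g) :
    f = g := by
  obtain ⟨k, c, h1, h2, rfl⟩ := hf
  obtain ⟨k', c', h1', h2', rfl⟩ := hg
  have e := config_of_spans h1 h2 (le_max_left k k')
  rw [config_of_spans h1' h2' (le_max_right k k')] at e
  simp only [Option.some.injEq] at e
  rw [e]

/-- Loop erasure preserves chains, so every edge built inherits a relation satisfied by all steps of
the walks. It is applied with `r i j := 0 < P i j`. -/
theorem rel_of_mem_edges {r : S → S → Prop} (hr : ∀ k n, r (x k n) (x k (n + 1)))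
    (h : config R x k = some c) {e : S × S} (he : e ∈ c.edges) : r e.1 e.2 := by
  induction k generalizing c with
  | zero =>
    obtain rfl : ⟨∅, ∅⟩ = c := by simpa [config] using h
    simp at he
  | succ k ih =>
    obtain ⟨c', h1, ⟨-, rfl⟩ | ⟨-, h2⟩⟩ := exists_config_of_succ h
    · exact ih h1 he
    · obtain ⟨n, hn⟩ := stage_eq_some_iff.1 h2
      rw [← hn.2.2] at he
      rcases Finset.mem_union.1 he with he | he
      · exact ih h1 he
      · refine rel_of_mem_pathEdges (isChain_loopErasure ?_) he
        rw [List.isChain_map]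
        exact (List.isChain_range_succ _ _).2 fun m _ => hr k m

/-- If the graph generated in the end is `f`, the next path added to a configuration is the path
of `f` from the starting point. -/
theorem Generates.hitsVia {f : Finset (S × S)} (hf : IsForest f) (h : Generates R x f)
    (hc : config R x k = some c) (hs : ¬ c.Spans R) {u : List S}
    (hu : StopsAt (R ∪ c.visited) u) (cu : u.IsChain fun i j => (i, j) ∈ f)
    (hh : u.head? = some (x k 0)) :
    ∃ n, HitsVia (R ∪ c.visited) n {l | loopErasure l = u} (x k) := by
  obtain ⟨k', c', h1, h2, rfl⟩ := h
  have hk : k + 1 ≤ k' := by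
    by_contra! hlt
    have := config_of_spans h1 h2 (Nat.lt_succ_iff.1 hlt)
    rw [hc] at this
    simp only [Option.some.injEq] at this
    exact hs (this ▸ h2)
  obtain ⟨c1, h3, h4⟩ := exists_config_of_le h1 hk
  rw [config_succ_of_not_spans hc hs] at h3
  obtain ⟨n, hn, hst, hhd⟩ := exists_addPath_of_stage_eq h3
  refine ⟨n, hn.1, hn.2.1, hst.unique hf.1 hu ((isChain_pathEdges _).imp fun i j hij => h4 ?_) cu
    (hhd.trans hh.symm)⟩
  rw [← hn.2.2]
  exact Finset.mem_union_right _ hij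

end Algorithm

/-! ### Hitting probabilities by first-step recursion -/

section HitProb

open scoped ENNReal

variable {S : Type*} [Fintype S] [DecidableEq S]

/-- The probability that the Markov chain with transition probabilities `p`, started at `s`, first
hits `T` at time `n` with its path up to that time in `φ`. -/
noncomputable def hitProbAt (p : S → S → ℝ≥0∞) (T : Finset S) : ℕ → Set (List S) → S → ℝ≥0∞
  | 0, φ, s => if s ∈ T then φ.indicator 1 [s] else 0
  | n + 1, φ, s => if s ∈ T then 0 else ∑ j, p s j * hitProbAt p T n {l | s :: l ∈ φ} j

/-- The probability that the Markov chain with transition probabilities `p`, started at `s`, hits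
`T` with its path up to the first hitting time in `φ`. -/
noncomputable def hitProb (p : S → S → ℝ≥0∞) (T : Finset S) (φ : Set (List S)) (s : S) : ℝ≥0∞ :=
  ∑' n, hitProbAt p T n φ s

variable {p : S → S → ℝ≥0∞} {T : Finset S} {φ ψ : Set (List S)} {s : S}

theorem hitProbAt_congr {n : ℕ} (h : ∀ l, StopsAt T l → l.head? = some s → (l ∈ φ ↔ l ∈ ψ)) :
    hitProbAt p T n φ s = hitProbAt p T n ψ s := by
  classical
  induction n generalizing φ ψ s with
  | zero =>
    by_cases hs : s ∈ T
    · simp only [hitProbAt, hs, if_true, Set.indicator_apply]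
      exact if_congr (h [s] (.single hs) rfl) rfl rfl
    · simp [hitProbAt, hs]
  | succ n ih =>
    by_cases hs : s ∈ T
    · simp [hitProbAt, hs]
    · simp only [hitProbAt, hs, if_false]
      refine Finset.sum_congr rfl fun j _ => ?_
      rw [ih (φ := {l | s :: l ∈ φ}) (ψ := {l | s :: l ∈ ψ})
        fun l hl _ => h (s :: l) (.cons hs hl) rfl]

theorem hitProb_congr (h : ∀ l, StopsAt T l → l.head? = some s → (l ∈ φ ↔ l ∈ ψ)) :
    hitProb p T φ s = hitProb p T ψ s :=
  tsum_congr fun _ => hitProbAt_congr h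

@[simp] theorem hitProbAt_empty (n : ℕ) : hitProbAt p T n ∅ s = 0 := by
  induction n generalizing s with
  | zero => simp [hitProbAt]
  | succ n ih =>
    simp [hitProbAt, ih]

@[simp] theorem hitProb_empty : hitProb p T ∅ s = 0 := by
  simp [hitProb]

theorem hitProb_eq_zero (h : ∀ l, StopsAt T l → l.head? = some s → l ∉ φ) :
    hitProb p T φ s = 0 := by
  rw [hitProb_congr (ψ := ∅) fun l h1 h2 => by simpa using h l h1 h2, hitProb_empty]

theorem hitProb_of_notMem (hs : s ∉ T) :
    hitProb p T φ s = ∑ j, p s j * hitProb p T {l | s :: l ∈ φ} j := by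
  rw [hitProb, tsum_eq_zero_add' ENNReal.summable]
  simp only [hitProbAt, hs, if_false, zero_add]
  rw [Summable.tsum_finsetSum fun _ _ => ENNReal.summable]
  simp [hitProb, ENNReal.tsum_mul_left]

open Classical in
theorem hitProb_of_mem (hs : s ∈ T) : hitProb p T φ s = if [s] ∈ φ then 1 else 0 := by
  rw [hitProb, tsum_eq_zero_add' ENNReal.summable]
  simp [hitProbAt, hs, Set.indicator_apply]

theorem hitProb_inter_add_diff (φ ψ : Set (List S)) :
    hitProb p T φ s = hitProb p T (φ ∩ ψ) s + hitProb p T (φ \ ψ) s := by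
  simp only [hitProb]
  rw [← ENNReal.tsum_add]
  refine tsum_congr fun n => ?_
  induction n generalizing φ ψ s with
  | zero => by_cases hs : s ∈ T <;> by_cases h1 : [s] ∈ φ <;> by_cases h2 : [s] ∈ ψ <;>
      simp [hitProbAt, hs, h1, h2]
  | succ n ih =>
    by_cases hs : s ∈ T
    · simp [hitProbAt, hs]
    · simp only [hitProbAt, hs, if_false]
      rw [← Finset.sum_add_distrib]
      refine Finset.sum_congr rfl fun j _ => ?_
      rw [ih _ {l | s :: l ∈ ψ}, mul_add]
      rfl

theorem hitProb_le_one (hp : ∀ i, ∑ j, p i j ≤ 1) : hitProb p T φ s ≤ 1 := by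
  refine ENNReal.tsum_le_of_sum_range_le fun N => ?_
  -- The partial sum bounds hitting within fewer than `N` steps; conditioning on the first step
  -- lowers `N` by one.
  induction N generalizing φ s with
  | zero => simp
  | succ N ih =>
    rw [Finset.sum_range_succ']
    by_cases hs : s ∈ T
    · simp only [hitProbAt, hs, if_true, Finset.sum_const_zero, zero_add]
      exact Set.indicator_le_self' (fun _ _ => zero_le_one) _
    · simp only [hitProbAt, hs, if_false, add_zero]
      rw [Finset.sum_comm]
      refine le_trans (Finset.sum_le_sum fun j _ => ?_) (hp s)
      rw [← Finset.mul_sum]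
      exact mul_le_of_le_one_right' ih

/-- For paths avoiding `a` it does not matter whether the chain is stopped at `a`. -/
theorem hitProb_insert_of_notMem (a : S) (h : ∀ l ∈ φ, a ∉ l) :
    hitProb p (insert a T) φ s = hitProb p T φ s := by
  refine tsum_congr fun n => ?_
  induction n generalizing φ s with
  | zero =>
    by_cases hs : [s] ∈ φ
    · have : s ≠ a := fun e => h _ hs (by simp [e])
      simp [hitProbAt, this]
    · simp [hitProbAt, hs]
  | succ n ih =>
    by_cases hs : s = a
    · have : ({l | s :: l ∈ φ} : Set (List S)) = ∅ := by
        ext l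
        simp only [Set.mem_ofPred_eq, Set.mem_empty_iff_false, iff_false]
        exact fun hl => h _ hl (by simp [hs])
      simp only [hitProbAt, this]
      simp
    · simp only [hitProbAt, Finset.mem_insert, hs, false_or]
      split_ifs
      · rfl
      · refine Finset.sum_congr rfl fun j _ => ?_
        rw [ih (φ := {l | s :: l ∈ φ}) fun l hl ha => h (s :: l) hl (List.mem_cons_of_mem _ ha)]

end HitProb

/-! ### Determinants with absorbing rows -/

section Absorb

variable {S : Type*} [Fintype S] [DecidableEq S]

/-- The matrix `1 - P`, with the rows indexed by `T` replaced by those of the identity matrix. -/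
def absorb (P : Matrix S S ℝ) (T : Finset S) : Matrix S S ℝ :=
  Matrix.of fun i => if i ∈ T then Pi.single i 1 else (1 - P) i

theorem absorb_mulVec_of_mem (P : Matrix S S ℝ) {T : Finset S} {i : S} (hi : i ∈ T) (v : S → ℝ) :
    (absorb P T).mulVec v i = v i := by
  simp [absorb, Matrix.mulVec, hi]

theorem absorb_mulVec_of_notMem (P : Matrix S S ℝ) {T : Finset S} {i : S} (hi : i ∉ T)
    (v : S → ℝ) : (absorb P T).mulVec v i = v i - ∑ j, P i j * v j := by
  have : (absorb P T).mulVec v i = (1 - P).mulVec v i := by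
    simp [absorb, Matrix.mulVec, hi]
  rw [this, Matrix.sub_mulVec, Matrix.one_mulVec]
  rfl

theorem adjugate_absorb_self (P : Matrix S S ℝ) (T : Finset S) (a : S) :
    (absorb P T).adjugate a a = (absorb P (insert a T)).det := by
  rw [Matrix.adjugate_apply]
  congr 1
  ext i j
  by_cases h : i = a
  · subst h
    simp [absorb]
  · simp [absorb, h, Matrix.updateRow_ne]

theorem det_absorb_univ (P : Matrix S S ℝ) : (absorb P Finset.univ).det = 1 := by
  have : absorb P Finset.univ = 1 := by
    ext i j
    simp [absorb, Matrix.one_apply, Pi.single_apply, eq_comm]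
  rw [this, Matrix.det_one]

/-- Cramer's rule at the entry `a`, in adjugate form so that `absorb P T` need not be invertible. -/
theorem det_absorb_mul_eq (P : Matrix S S ℝ) (T : Finset S) {a : S} {v : S → ℝ} {c : ℝ}
    (h : (absorb P T).mulVec v = Pi.single a c) :
    (absorb P T).det * v a = (absorb P (insert a T)).det * c := by
  have h1 : (absorb P T).adjugate.mulVec ((absorb P T).mulVec v) = (absorb P T).det • v := by
    rw [Matrix.mulVec_mulVec, Matrix.adjugate_mul, Matrix.smul_mulVec, Matrix.one_mulVec]
  have h2 := congrFun h1 a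
  rw [h, Matrix.mulVec_single] at h2
  rw [← adjugate_absorb_self]
  simpa [mul_comm] using h2.symm

end Absorb

/-! ### The law of the loop erasure -/

section LoopErasedProb

variable {S : Type*} [Fintype S] [DecidableEq S] {P : Matrix S S ℝ}

/-- Transition probabilities as extended nonnegative real numbers. -/
noncomputable abbrev transition (P : Matrix S S ℝ) (i j : S) : ENNReal := ENNReal.ofReal (P i j)

omit [DecidableEq S] in
theorem sum_transition (hP0 : ∀ i j, 0 ≤ P i j) (hP1 : ∀ i, ∑ j, P i j = 1) (i : S) :
    ∑ j, transition P i j = 1 := by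
  rw [← ENNReal.ofReal_sum_of_nonneg fun j _ => hP0 i j, hP1, ENNReal.ofReal_one]

/-- `hitProb` as a real number. -/
noncomputable def hitReal (P : Matrix S S ℝ) (T : Finset S) (φ : Set (List S)) (s : S) : ℝ :=
  (hitProb (transition P) T φ s).toReal

variable (hP0 : ∀ i j, 0 ≤ P i j) (hP1 : ∀ i, ∑ j, P i j = 1) {T : Finset S} {φ : Set (List S)}
  {s : S}

include hP0 hP1

theorem hitProb_ne_top : hitProb (transition P) T φ s ≠ ⊤ :=
  ((hitProb_le_one fun i => (sum_transition hP0 hP1 i).le).trans_lt ENNReal.one_lt_top).ne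

theorem hitReal_of_notMem (hs : s ∉ T) :
    hitReal P T φ s = ∑ j, P s j * hitReal P T {l | s :: l ∈ φ} j := by
  rw [hitReal, hitProb_of_notMem hs, ENNReal.toReal_sum
    fun j _ => ENNReal.mul_ne_top ENNReal.ofReal_ne_top (hitProb_ne_top hP0 hP1)]
  simp [hitReal, ENNReal.toReal_ofReal (hP0 _ _)]

theorem hitReal_inter_add_diff (φ ψ : Set (List S)) :
    hitReal P T φ s = hitReal P T (φ ∩ ψ) s + hitReal P T (φ \ ψ) s := by
  rw [hitReal, hitProb_inter_add_diff φ ψ,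
    ENNReal.toReal_add (hitProb_ne_top hP0 hP1) (hitProb_ne_top hP0 hP1)]
  rfl

/-- Let `v j` be the probability that the walk from `j` visits `a` before stopping at `T` and that,
after its last visit to `a`, the loop erasure is `b :: u`. Then `v` vanishes on `T` and is harmonic
elsewhere except at `a`, where the defect is the probability of stepping to `b` and never returning.
Thus `absorb P T` maps `v` to a multiple of the unit vector at `a`, and Cramer's rule applies. -/
theorem det_absorb_mul_hitReal_cons {a b : S} {u : List S} (ha : a ∉ T)
    (hu : StopsAt T (b :: u)) (hau : a ∉ b :: u) :
    (absorb P T).det * hitReal P T {l | loopErasure l = a :: b :: u} a =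
      (absorb P (insert a T)).det *
        (P a b * hitReal P (insert a T) {l | loopErasure l = b :: u} b) := by
  let after : List S → List S := fun l => l.rtakeWhile (fun y => y ≠ a)
  let ψ : Set (List S) := {l | loopErasure (after l) = b :: u}
  let χ : Set (List S) := {l | a ∈ l}
  let v : S → ℝ := hitReal P T (ψ ∩ χ)
  -- If `a` is never visited, nothing is cut off: the path must start at `b`, and also stopping at
  -- `a` changes nothing.
  have hdiff : ∀ j, hitReal P T (ψ \ χ) j =
      if j = b then hitReal P (insert a T) {l | loopErasure l = b :: u} b else 0 := by
    intro j
    have e : ∀ l, a ∉ l → (l ∈ ψ ↔ loopErasure l = b :: u) := fun l hl => by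
      change loopErasure (l.rtakeWhile _) = _ ↔ _
      rw [rtakeWhile_ne_of_notMem hl]
    split_ifs with hj
    · subst hj
      rw [hitReal, hitReal, ← hitProb_insert_of_notMem a fun l hl => hl.2]
      congr 1
      refine hitProb_congr fun l hl _ => ⟨fun h => (e l h.2).1 h.1, fun h => ?_⟩
      -- A path stopped at `insert a T` can meet `a` only at its end, and loop erasure keeps the
      -- last vertex.
      have hal : a ∉ l := by
        intro hal
        have h1 := hl.getLast?_eq_of_mem hal (Finset.mem_insert_self a T)
        rw [← getLast?_loopErasure, show loopErasure l = j :: u from h] at h1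
        exact hau (List.mem_of_getLast? h1)
      exact ⟨(e l hal).2 h, hal⟩
    · rw [hitReal, hitProb_eq_zero, ENNReal.toReal_zero]
      rintro l - hl ⟨h1, h2⟩
      rw [e l h2] at h1
      rw [← head?_loopErasure, h1] at hl
      simp only [List.head?_cons, Option.some.injEq] at hl
      exact hj hl.symm
  have hva : hitReal P T {l | loopErasure l = a :: b :: u} a = v a := by
    rw [hitReal]
    change _ = (hitProb _ _ _ _).toReal
    congr 1
    refine hitProb_congr fun l _ hl => ?_
    obtain ⟨l, rfl⟩ : ∃ l', l = a :: l' := by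
      cases l with
      | nil => simp at hl
      | cons x l => exact ⟨l, by simpa using hl⟩
    simp only [Set.mem_inter_iff, Set.mem_ofPred_eq, loopErasure_cons, List.cons.injEq, true_and,
      ψ, χ, after, rtakeWhile_ne_cons_self, List.mem_cons, true_or, and_true]
  rw [hva]
  refine det_absorb_mul_eq P T ?_
  ext i
  by_cases hi : i ∈ T
  · have hia : i ≠ a := fun e => ha (e ▸ hi)
    rw [absorb_mulVec_of_mem P hi, Pi.single_eq_of_ne hia]
    change (hitProb _ _ _ _).toReal = 0
    rw [hitProb_of_mem hi, if_neg, ENNReal.toReal_zero]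
    rintro ⟨-, h⟩
    exact hia (List.mem_singleton.1 h).symm
  rw [absorb_mulVec_of_notMem P hi, sub_eq_iff_eq_add]
  change hitReal P T (ψ ∩ χ) i = _
  rw [hitReal_of_notMem hP0 hP1 hi]
  by_cases hia : i = a
  · subst hia
    have e : ({l | i :: l ∈ ψ ∩ χ} : Set (List S)) = ψ := by
      ext l
      simp only [Set.mem_inter_iff, Set.mem_ofPred_eq, ψ, χ, after, rtakeWhile_ne_cons_self,
        List.mem_cons, true_or, and_true]
    rw [e, Pi.single_eq_same]
    -- After the first step, either the walk returns to `a`, giving the harmonic term, or it does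
    -- not, giving the defect.
    simp only [hitReal_inter_add_diff hP0 hP1 ψ χ, hdiff, mul_add, Finset.sum_add_distrib]
    rw [add_comm]
    congr 1
    simp
  · rw [Pi.single_eq_of_ne hia, zero_add]
    refine Finset.sum_congr rfl fun j _ => ?_
    congr 2
    ext l
    simp only [Set.mem_inter_iff, Set.mem_ofPred_eq, ψ, χ, after, List.mem_cons, Ne.symm hia,
      false_or]
    refine and_congr_left fun hl => ?_
    rw [rtakeWhile_ne_cons_of_mem i hl]

/-- The law of the loop erasure of a Markov chain stopped at the first visit to `T`. -/
theorem det_absorb_mul_hitReal_loopErasure {u : List S} (hu : StopsAt T u) (hn : u.Nodup)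
    (hs : u.head? = some s) :
    (absorb P T).det * hitReal P T {l | loopErasure l = u} s =
      weight P (pathEdges u) * (absorb P (T ∪ u.toFinset)).det := by
  induction u generalizing T s with
  | nil => simp at hs
  | cons a u ih =>
    obtain rfl : a = s := by simpa using hs
    cases u with
    | nil =>
      have ha : a ∈ T := by
        cases hu with
        | single h => exact h
        | cons _ h => exact absurd rfl h.ne_nil
      have h1 : loopErasure [a] = [a] := by simp [loopErasure_cons, List.rtakeWhile]
      have h2 : T ∪ {a} = T := by simpa using ha
      rw [hitReal, hitProb_of_mem ha]
      simp [h1, h2, weight]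
    | cons b u =>
      rw [List.nodup_cons] at hn
      obtain ⟨ha, hbu⟩ := hu.of_cons (by simp)
      -- The rest of the path is treated with `a` made absorbing, so the remaining walk may not
      -- return to it.
      have h1 := ih (hbu.insert hn.1) hn.2 rfl
      rw [det_absorb_mul_hitReal_cons hP0 hP1 ha hbu hn.1, weight_pathEdges_cons_cons P hn.1]
      have h2 : insert a T ∪ (b :: u).toFinset = T ∪ (a :: b :: u).toFinset := by
        ext x
        simp only [List.toFinset_cons, Finset.mem_union, Finset.mem_insert]
        tauto
      rw [h2] at h1
      linear_combination P a b * h1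

/-- The maximum principle: if every vertex is connected to `T` by a path of positive weight, then
a function vanishing on `T` and harmonic elsewhere is zero. -/
theorem eq_zero_of_absorb_mulVec_eq_zero {f : Finset (S × S)} (hf : IsForest f)
    (hfT : roots f ⊆ T) (hpos : ∀ i j, (i, j) ∈ f → 0 < P i j) {v : S → ℝ}
    (hv : (absorb P T).mulVec v = 0) : v = 0 := by
  by_contra hne
  obtain ⟨i₀, hi₀⟩ := Function.ne_iff.1 hne
  obtain ⟨m, -, hm⟩ := Finset.exists_max_image Finset.univ (fun i => |v i|) ⟨i₀, by simp⟩
  have hmpos : 0 < |v m| := (abs_pos.2 hi₀).trans_le (hm i₀ (by simp))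
  -- Among the maximizers of `|v|`, choose one whose forest successor is no longer a maximizer;
  -- averaging then gives a strict inequality.
  obtain ⟨i, hi, hmin⟩ := hf.wellFounded.has_min {i | |v i| = |v m|} ⟨m, rfl⟩
  have hi : |v i| = |v m| := hi
  have hvi := congrFun hv i
  have hiT : i ∉ T := by
    intro h
    rw [absorb_mulVec_of_mem P h, Pi.zero_apply] at hvi
    rw [hvi, abs_zero] at hi
    exact hmpos.ne hi
  rw [absorb_mulVec_of_notMem P hiT, Pi.zero_apply, sub_eq_zero] at hvi
  obtain ⟨j, hj⟩ := exists_edge_of_notMem_roots fun h => hiT (hfT h)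
  have hlt : |v j| < |v m| := lt_of_le_of_ne (hm j (by simp)) fun h => hmin j h hj
  refine absurd hi (ne_of_lt ?_)
  calc |v i| = |∑ j, P i j * v j| := by rw [← hvi]
    _ ≤ ∑ j, |P i j * v j| := Finset.abs_sum_le_sum_abs _ _
    _ = ∑ j, P i j * |v j| := by simp only [abs_mul, abs_of_nonneg (hP0 _ _)]
    _ < ∑ j, P i j * |v m| := Finset.sum_lt_sum
        (fun k _ => mul_le_mul_of_nonneg_left (hm k (by simp)) (hP0 i k))
        ⟨j, by simp, mul_lt_mul_of_pos_left hlt (hpos i j hj)⟩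
    _ = |v m| := by rw [← Finset.sum_mul, hP1, one_mul]

theorem det_absorb_ne_zero {f : Finset (S × S)} (hf : IsForest f)
    (hfT : roots f ⊆ T) (hpos : ∀ i j, (i, j) ∈ f → 0 < P i j) : (absorb P T).det ≠ 0 := by
  intro h
  obtain ⟨v, hv, h0⟩ := Matrix.exists_mulVec_eq_zero_iff.2 h
  exact hv (eq_zero_of_absorb_mulVec_eq_zero hP0 hP1 hf hfT hpos h0)

/-- The probability of never hitting `T` vanishes on `T` and is harmonic elsewhere, so the maximum
principle applies. -/
theorem hitProb_univ_eq_one {f : Finset (S × S)} (hf : IsForest f)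
    (hfT : roots f ⊆ T) (hpos : ∀ i j, (i, j) ∈ f → 0 < P i j) (s : S) :
    hitProb (transition P) T Set.univ s = 1 := by
  have h : (fun i => 1 - hitReal P T Set.univ i) = 0 := by
    refine eq_zero_of_absorb_mulVec_eq_zero hP0 hP1 hf hfT hpos ?_
    ext i
    by_cases hi : i ∈ T
    · rw [absorb_mulVec_of_mem P hi, hitReal, hitProb_of_mem hi]
      simp
    · rw [absorb_mulVec_of_notMem P hi, hitReal_of_notMem hP0 hP1 hi]
      simp [mul_sub, hP1]
  have h1 : hitReal P T Set.univ s = 1 := by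
    have := congrFun h s
    simp only [Pi.zero_apply] at this
    linarith
  rwa [hitReal, ENNReal.toReal_eq_one_iff] at h1

end LoopErasedProb

/-! ### From conditional Markov chains to hitting probabilities -/

section Probability

variable {S Ω : Type*}

theorem measurableSet_hitsVia [Finite S] {m : MeasurableSpace Ω} {X : ℕ → Ω → S}
    (hX : ∀ n s, MeasurableSet[m] {ω | X n ω = s})
    (T : Finset S) (n : ℕ) (φ : Set (List S)) :
    MeasurableSet[m] {ω | HitsVia T n φ fun k => X k ω} := by
  induction n generalizing φ X with
  | zero =>
    have : {ω | HitsVia T 0 φ fun k => X k ω} =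
        ⋃ s ∈ {s | s ∈ T ∧ [s] ∈ φ}, {ω | X 0 ω = s} := by
      ext ω
      simp [hitsVia_zero]
    rw [this]
    exact MeasurableSet.biUnion (Set.to_countable _) fun s _ => hX 0 s
  | succ n ih =>
    have : {ω | HitsVia T (n + 1) φ fun k => X k ω} =
        ⋃ s ∈ {s | s ∉ T}, {ω | X 0 ω = s} ∩
          {ω | HitsVia T n {l | s :: l ∈ φ} fun k => X (k + 1) ω} := by
      ext ω
      simp [hitsVia_succ]
    rw [this]
    exact MeasurableSet.biUnion (Set.to_countable _) fun s _ =>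
      (hX 0 s).inter (ih (X := fun k => X (k + 1)) (fun k => hX (k + 1)) _)

variable {m : MeasurableSpace Ω} [mΩ : MeasurableSpace Ω] {μ : Measure Ω}

theorem measure_eq_sum_fibers [Fintype S] {f : Ω → S} (hf : ∀ s, MeasurableSet {ω | f ω = s})
    (B : Set Ω) : μ B = ∑ s, μ (B ∩ {ω | f ω = s}) := by
  have h := sum_measure_preimage_singleton (μ := μ.restrict B) Finset.univ fun s _ => hf s
  rw [Finset.coe_univ, Set.preimage_univ, Measure.restrict_apply_univ] at h
  rw [← h]
  refine Finset.sum_congr rfl fun s _ => ?_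
  rw [Set.inter_comm]
  exact Measure.restrict_apply (hf s)

variable [Fintype S] {P : Matrix S S ℝ} {X : ℕ → Ω → S} {A : Set Ω}

/-- The probability of hitting `T` at a given time along a given kind of path, for a Markov chain
whose first steps are prescribed. -/
theorem IsChainGiven.measure_hitsVia_shift [DecidableEq S] (h : IsChainGiven P μ m X)
    (hX : ∀ n s, MeasurableSet {ω | X n ω = s}) (hA : MeasurableSet[m] A) (T : Finset S) (n : ℕ)
    (φ : Set (List S)) (i : ℕ) (y : ℕ → S) :
    μ (A ∩ {ω | ∀ k ≤ i, X k ω = y k} ∩ {ω | HitsVia T n φ fun k => X (i + k) ω}) =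
      μ (A ∩ {ω | X 0 ω = y 0}) * (∏ k ∈ Finset.range i, transition P (y k) (y (k + 1))) *
        hitProbAt (transition P) T n φ (y i) := by
  induction n generalizing φ i y with
  | zero =>
    rw [← h A hA i y]
    by_cases hy : y i ∈ T ∧ [y i] ∈ φ
    · have : A ∩ {ω | ∀ k ≤ i, X k ω = y k} ∩ {ω | HitsVia T 0 φ fun k => X (i + k) ω} =
          A ∩ {ω | ∀ k ≤ i, X k ω = y k} := by
        refine Set.inter_eq_left.2 fun ω hω => ?_
        simpa [hitsVia_zero, hω.2 i le_rfl] using hy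
      rw [this]
      simp [hitProbAt, hy]
    · have : A ∩ {ω | ∀ k ≤ i, X k ω = y k} ∩ {ω | HitsVia T 0 φ fun k => X (i + k) ω} = ∅ := by
        refine Set.eq_empty_of_forall_notMem fun ω hω => hy ?_
        simpa [hitsVia_zero, hω.1.2 i le_rfl] using hω.2
      rw [this]
      simp only [hitProbAt, measure_empty]
      by_cases hT : y i ∈ T <;> simp_all
  | succ n ih =>
    by_cases hy : y i ∈ T
    · have : A ∩ {ω | ∀ k ≤ i, X k ω = y k} ∩ {ω | HitsVia T (n + 1) φ fun k => X (i + k) ω} =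
          ∅ := by
        refine Set.eq_empty_of_forall_notMem fun ω hω => ?_
        have h1 := (hitsVia_succ (x := fun k => X (i + k) ω).1 hω.2).1
        rw [add_zero, hω.1.2 i le_rfl] at h1
        exact h1 hy
      rw [this]
      simp [hitProbAt, hy]
    · rw [measure_eq_sum_fibers (hX (i + 1))]
      simp only [hitProbAt, hy, if_false]
      rw [Finset.mul_sum]
      refine Finset.sum_congr rfl fun j _ => ?_
      -- Fixing the next state turns it into one more prescribed step, which is why the induction is
      -- stated for arbitrary prefixes.
      let z : ℕ → S := Function.update y (i + 1) j
      have hz : ∀ k ≤ i, z k = y k := fun k hk => Function.update_of_ne (by omega) _ _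
      have hzi : z (i + 1) = j := Function.update_self _ _ _
      have hset : A ∩ {ω | ∀ k ≤ i, X k ω = y k} ∩
          {ω | HitsVia T (n + 1) φ fun k => X (i + k) ω} ∩ {ω | X (i + 1) ω = j} =
          A ∩ {ω | ∀ k ≤ i + 1, X k ω = z k} ∩
            {ω | HitsVia T n {l | y i :: l ∈ φ} fun k => X (i + 1 + k) ω} := by
        have e1 : ∀ ω, (∀ k ≤ i + 1, X k ω = z k) ↔
            (∀ k ≤ i, X k ω = y k) ∧ X (i + 1) ω = j := by
          intro ω
          constructor
          · exact fun H => ⟨fun k hk => (H k (by omega)).trans (hz k hk),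
              (H _ le_rfl).trans hzi⟩
          · rintro ⟨H1, H2⟩ k hk
            rcases Nat.le_succ_iff.1 hk with hk | rfl
            · exact (H1 k hk).trans (hz k hk).symm
            · exact H2.trans hzi.symm
        ext ω
        simp only [Set.mem_inter_iff, Set.mem_ofPred_eq, e1, hitsVia_succ, add_zero]
        have e2 : (fun k => X (i + (k + 1)) ω) = fun k => X (i + 1 + k) ω := by
          ext k
          congr 1
          omega
        rw [e2]
        constructor
        · rintro ⟨⟨⟨h1, h2⟩, h3, h4⟩, h5⟩
          rw [h2 i le_rfl] at h4
          exact ⟨⟨h1, h2, h5⟩, h4⟩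
        · rintro ⟨⟨h1, h2, h5⟩, h4⟩
          rw [h2 i le_rfl]
          exact ⟨⟨⟨h1, h2⟩, hy, h4⟩, h5⟩
      rw [hset, ih, hzi, hz 0 (by omega), Finset.prod_range_succ, hzi, hz i le_rfl]
      have : ∏ k ∈ Finset.range i, transition P (z k) (z (k + 1)) =
          ∏ k ∈ Finset.range i, transition P (y k) (y (k + 1)) :=
        Finset.prod_congr rfl fun k hk => by
          rw [Finset.mem_range] at hk
          rw [hz k hk.le, hz (k + 1) hk]
      rw [this]
      simp only [mul_assoc]

theorem IsChainGiven.measure_hitsVia [DecidableEq S] (h : IsChainGiven P μ m X)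
    (hX : ∀ n s, MeasurableSet {ω | X n ω = s}) (hm : m ≤ mΩ) (hA : MeasurableSet[m] A) {s : S}
    (hAs : ∀ ω ∈ A, X 0 ω = s) (T : Finset S) (φ : Set (List S)) :
    μ (A ∩ {ω | ∃ n, HitsVia T n φ fun k => X k ω}) = μ A * hitProb (transition P) T φ s := by
  have hU : A ∩ {ω | ∃ n, HitsVia T n φ fun k => X k ω} =
      ⋃ n, A ∩ {ω | HitsVia T n φ fun k => X k ω} := by
    ext ω
    simp
  rw [hU, measure_iUnion, hitProb, ← ENNReal.tsum_mul_left]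
  · refine tsum_congr fun n => ?_
    have h1 := h.measure_hitsVia_shift hX hA T n φ 0 fun _ => s
    have h2 : A ∩ {ω | X 0 ω = s} = A := Set.inter_eq_left.2 hAs
    simpa [h2] using h1
  · intro i j hij
    refine Set.disjoint_left.2 fun ω hi hj => hij ?_
    exact HitsVia.eq (x := fun k => X k ω) hi.2 hj.2
  · exact fun n => (hm _ hA).inter (measurableSet_hitsVia hX T n φ)

/-- Almost surely, a Markov chain only makes steps of positive probability. -/
theorem IsChainGiven.ae_pos (h : IsChainGiven P μ m X) :
    ∀ᵐ ω ∂μ, ∀ n, 0 < P (X n ω) (X (n + 1) ω) := by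
  rw [ae_all_iff]
  intro n
  have h1 : ∀ y : Fin (n + 2) → S, ∀ᵐ ω ∂μ, (∀ k, X k.1 ω = y k) →
      0 < P (y (Fin.last n).castSucc) (y (Fin.last (n + 1))) := by
    intro y
    by_cases hy : 0 < P (y (Fin.last n).castSucc) (y (Fin.last (n + 1)))
    · exact Filter.Eventually.of_forall fun _ _ => hy
    -- `Fin.ofNat` merely extends `y` to `ℕ`; only indices up to `n + 1` matter.
    have h2 := h Set.univ MeasurableSet.univ (n + 1) fun k => y (Fin.ofNat (n + 2) k)
    rw [Finset.prod_range_succ, ENNReal.ofReal_of_nonpos (p := P _ _), mul_zero, mul_zero,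
      Set.univ_inter] at h2
    · rw [ae_iff]
      refine measure_mono_null (fun ω hω => ?_) h2
      simp only [Set.mem_ofPred_eq, Classical.not_imp] at hω ⊢
      intro k hk
      rw [← hω.1]
      simp [Fin.ofNat, Nat.mod_eq_of_lt (Nat.lt_succ_of_le hk)]
    · have e1 : Fin.ofNat (n + 2) n = (Fin.last n).castSucc := by
        ext
        simp [Fin.ofNat]
      have e2 : Fin.ofNat (n + 2) (n + 1) = Fin.last (n + 1) := by
        ext
        simp [Fin.ofNat]
      rw [e1, e2]
      exact not_lt.1 hy
  filter_upwards [ae_all_iff.2 h1] with ω hω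
  exact hω (fun k => X k ω) fun _ => rfl

end Probability

/-! ### Termination and output law under random input -/

section Wilson

variable {S Ω : Type*} [Fintype S] [DecidableEq S] [mΩ : MeasurableSpace Ω] {P : Matrix S S ℝ}
  {R : Finset S} {μ : Measure Ω} {ℱ : Filtration ℕ mΩ} {X : ℕ → ℕ → Ω → S}

instance : Finite (Config S) :=
  Finite.of_injective (fun c : Config S => (c.edges, c.visited)) fun c c' h => by
    cases c
    cases c'
    simp_all

namespace IsWilsonInput

theorem measurableSet_walk (hX : IsWilsonInput P R μ ℱ X) (k n : ℕ) (s : S) :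
    MeasurableSet {ω | X k n ω = s} :=
  ℱ.le _ _ (hX.measurable_walk k n s)

theorem measurableSet_config (hX : IsWilsonInput P R μ ℱ X) (k : ℕ) (c : Config S) :
    MeasurableSet[ℱ k] {ω | config R (fun j n => X j n ω) k = some c} := by
  induction k generalizing c with
  | zero => simp [config]
  | succ k ih =>
    have : {ω | config R (fun j n => X j n ω) (k + 1) = some c} =
        ⋃ c', {ω | config R (fun j n => X j n ω) k = some c'} ∩
          ({ω | c'.Spans R ∧ c' = c} ∪ ({ω | ¬ c'.Spans R} ∩ ⋃ n, {ω | HitsVia (R ∪ c'.visited) n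
            {l | c'.addPath (loopErasure l) = c} fun n => X k n ω})) := by
      ext ω
      simp only [Set.mem_iUnion, Set.mem_inter_iff, Set.mem_union, Set.mem_ofPred_eq]
      constructor
      · intro h
        obtain ⟨c', h1, h2⟩ := exists_config_of_succ h
        rw [stage_eq_some_iff] at h2
        exact ⟨c', h1, h2⟩
      · rintro ⟨c', h1, ⟨h2, rfl⟩ | ⟨h2, h3⟩⟩
        · exact config_succ_of_spans h1 h2
        · rw [config_succ_of_not_spans h1 h2, stage_eq_some_iff]
          exact h3
    rw [this]
    refine MeasurableSet.iUnion fun c' => (ℱ.mono (Nat.le_succ k) _ (ih c')).inter ?_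
    refine (MeasurableSet.const _).union ((MeasurableSet.const _).inter
      (MeasurableSet.iUnion fun n => ?_))
    exact measurableSet_hitsVia (hX.measurable_walk k) _ _ _

theorem measurableSet_generates (hX : IsWilsonInput P R μ ℱ X) (f : Finset (S × S)) :
    MeasurableSet {ω | Generates R (fun k n => X k n ω) f} := by
  have : {ω | Generates R (fun k n => X k n ω) f} =
      ⋃ k, ⋃ c, {ω | config R (fun j n => X j n ω) k = some c} ∩
        {ω | c.Spans R ∧ c.edges = f} := by
    ext ω
    simp [Generates]
  rw [this]
  exact MeasurableSet.iUnion fun k => MeasurableSet.iUnion fun c =>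
    (ℱ.le _ _ (hX.measurableSet_config k c)).inter (MeasurableSet.const _)

variable (hP0 : ∀ i j, 0 ≤ P i j) (hP1 : ∀ i, ∑ j, P i j = 1)

include hP0 hP1

/-- If some forest with roots in `R` has positive weight, then almost surely all stages end. -/
theorem ae_config_ne_none (hX : IsWilsonInput P R μ ℱ X) {f : Finset (S × S)} (hf : IsForest f)
    (hfR : roots f ⊆ R) (hpos : ∀ i j, (i, j) ∈ f → 0 < P i j) [IsFiniteMeasure μ] (k : ℕ) :
    ∀ᵐ ω ∂μ, config R (fun j n => X j n ω) k ≠ none := by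
  induction k with
  | zero => simp [config]
  | succ k ih =>
    have hnull : ∀ (c : Config S) (s : S), ∀ᵐ ω ∂μ,
        config R (fun j n => X j n ω) k = some c → X k 0 ω = s →
          ∃ n, HitsVia (R ∪ c.visited) n Set.univ fun n => X k n ω := by
      intro c s
      let A : Set Ω := {ω | config R (fun j n => X j n ω) k = some c} ∩ {ω | X k 0 ω = s}
      let H : Set Ω := {ω | ∃ n, HitsVia (R ∪ c.visited) n Set.univ fun n => X k n ω}
      have hA : MeasurableSet[ℱ k] A := (hX.measurableSet_config k c).inter (hX.measurable_start k s)
      have hH : MeasurableSet H := by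
        have : H = ⋃ n, {ω | HitsVia (R ∪ c.visited) n Set.univ fun n => X k n ω} := by
          ext ω
          simp [H]
        rw [this]
        exact MeasurableSet.iUnion fun n => measurableSet_hitsVia (hX.measurableSet_walk k) _ _ _
      have h1 : μ (A ∩ H) = μ A := by
        rw [(hX.chain k).measure_hitsVia (hX.measurableSet_walk k) (ℱ.le k) hA (fun ω hω => hω.2),
          hitProb_univ_eq_one hP0 hP1 hf (hfR.trans Finset.subset_union_left) hpos, mul_one]
      have h2 : μ (A \ H) = 0 := by
        have h3 := measure_inter_add_sdiff (μ := μ) A hH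
        rw [h1] at h3
        exact (ENNReal.add_right_inj (measure_ne_top μ A)).1 (h3.trans (add_zero _).symm)
      rw [ae_iff]
      refine measure_mono_null (fun ω hω => ?_) h2
      simp only [Set.mem_ofPred_eq, Classical.not_imp] at hω
      exact ⟨⟨hω.1, hω.2.1⟩, hω.2.2⟩
    have hall := ae_all_iff.2 fun c => ae_all_iff.2 (hnull c)
    filter_upwards [ih, hall] with ω h1 h2
    obtain ⟨c, hc⟩ := Option.ne_none_iff_exists'.1 h1
    by_cases hs : c.Spans R
    · simp [config_succ_of_spans hc hs]
    · rw [config_succ_of_not_spans hc hs, Ne, stage_eq_none_iff, not_forall_not]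
      exact h2 c _ hc rfl

theorem ae_terminates (hX : IsWilsonInput P R μ ℱ X) {f : Finset (S × S)} (hf : IsForest f)
    (hfR : roots f ⊆ R) (hpos : ∀ i j, (i, j) ∈ f → 0 < P i j) [IsFiniteMeasure μ] :
    ∀ᵐ ω ∂μ, Terminates R fun k n => X k n ω := by
  filter_upwards [ae_all_iff.2 (hX.ae_config_ne_none hP0 hP1 hf hfR hpos),
    ae_all_iff.2 hX.start_new] with ω h1 h2
  exact terminates_of_config_ne_none h2 h1

/-- The conditional probability of generating the forest `f`, given that a part of it has been
built. -/
theorem det_absorb_mul_measure_generates (hX : IsWilsonInput P R μ ℱ X) [IsFiniteMeasure μ]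
    (hdet : ∀ T, R ⊆ T → (absorb P T).det ≠ 0) {f : Finset (S × S)} (hf : IsForest f)
    (hfR : roots f = R) (k : ℕ) (c : Config S)
    (hc : c.edges = f.filter fun e => e.1 ∈ c.visited) (A : Set Ω) (hA : MeasurableSet[ℱ k] A)
    (hAc : ∀ ω ∈ A, config R (fun j n => X j n ω) k = some c) :
    (absorb P (R ∪ c.visited)).det * μ.real (A ∩ {ω | Generates R (fun k n => X k n ω) f}) =
      weight P (f.filter fun e => e.1 ∉ c.visited) * μ.real A := by
  induction hN : (Finset.univ \ c.visited).card using Nat.strong_induction_on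
    generalizing k c A with
  | _ N ih =>
  have hsrc : ∀ e ∈ f, e.1 ∉ R := by
    rintro ⟨i, j⟩ he hi
    rw [← hfR, roots, Finset.mem_filter] at hi
    exact hi.2 j he
  by_cases hs : c.Spans R
  · have hvis : ∀ e ∈ f, e.1 ∈ c.visited := fun e he => by
      have : e.1 ∈ R ∪ c.visited := by rw [hs]; simp
      exact (Finset.mem_union.1 this).resolve_left (hsrc e he)
    have h1 : A ∩ {ω | Generates R (fun k n => X k n ω) f} = A := by
      refine Set.inter_eq_left.2 fun ω hω => ⟨k, c, hAc ω hω, hs, ?_⟩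
      rw [hc, Finset.filter_true_of_mem hvis]
    have h2 : (f.filter fun e => e.1 ∉ c.visited) = ∅ :=
      Finset.filter_false_of_mem fun e he => not_not.2 (hvis e he)
    rw [h1, h2, hs, det_absorb_univ]
    simp [weight]
  have key : ∀ s, (absorb P (R ∪ c.visited)).det *
      μ.real (A ∩ {ω | Generates R (fun k n => X k n ω) f} ∩ {ω | X k 0 ω = s}) =
      weight P (f.filter fun e => e.1 ∉ c.visited) * μ.real (A ∩ {ω | X k 0 ω = s}) := by
    intro s
    -- A visited starting state has probability zero, while an unvisited one makes the induction
    -- parameter drop, even if it lies in `R`.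
    by_cases hsv : s ∈ c.visited
    · have h0 : μ (A ∩ {ω | X k 0 ω = s}) = 0 := by
        refine measure_mono_null (fun ω hω => ?_) (ae_iff.1 (hX.start_new k))
        simp only [Set.mem_ofPred_eq, not_forall, not_not]
        exact ⟨c, hAc ω hω.1, hs, hω.2 ▸ hsv⟩
      have h1 : μ (A ∩ {ω | Generates R (fun k n => X k n ω) f} ∩ {ω | X k 0 ω = s}) = 0 :=
        measure_mono_null (Set.inter_subset_inter_left _ Set.inter_subset_left) h0
      simp [Measure.real, h0, h1]
    obtain ⟨u, hus, hu, cu⟩ := hf.exists_path (T := R ∪ c.visited)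
      (hfR.trans_subset Finset.subset_union_left) s
    have hn := hf.nodup cu
    let A' : Set Ω := A ∩ {ω | X k 0 ω = s}
    have hA' : MeasurableSet[ℱ k] A' := hA.inter (hX.measurable_start k s)
    let H : Set Ω := {ω | ∃ n, HitsVia (R ∪ c.visited) n {l | loopErasure l = u} fun n => X k n ω}
    have hH : MeasurableSet[ℱ (k + 1)] H := by
      have : H = ⋃ n, {ω | HitsVia (R ∪ c.visited) n {l | loopErasure l = u} fun n => X k n ω} := by
        ext ω
        simp [H]
      rw [this]
      exact MeasurableSet.iUnion fun n => measurableSet_hitsVia (hX.measurable_walk k) _ _ _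
    have hmem : ∀ e ∈ f, e ∈ pathEdges u ↔ e.1 ∈ u ∧ e.1 ∉ R ∪ c.visited := by
      intro e he
      refine ⟨fun h => ⟨fst_mem_of_mem_pathEdges h, hu.fst_notMem h⟩, fun h => ?_⟩
      obtain ⟨j, hj⟩ := hu.exists_mem_pathEdges h.1 h.2
      have : j = e.2 := hf.1 e.1 j e.2 (rel_of_mem_pathEdges cu hj) he
      rwa [this] at hj
    have hsub : pathEdges u ⊆ f := fun e he => rel_of_mem_pathEdges cu he
    have hvis : (c.addPath u).visited = c.visited ∪ u.toFinset := rfl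
    have hc' : (c.addPath u).edges = f.filter fun e => e.1 ∈ (c.addPath u).visited := by
      ext e
      simp only [Config.addPath, hc, Finset.mem_union, Finset.mem_filter, List.mem_toFinset]
      have h1 := hmem e
      have h2 := hsrc e
      have h3 := @hsub e
      simp only [Finset.mem_union] at h1
      tauto
    have hlt : (Finset.univ \ (c.addPath u).visited).card < N := by
      rw [← hN]
      refine Finset.card_lt_card (Finset.ssubset_iff_subset_ne.2
        ⟨Finset.sdiff_subset_sdiff subset_rfl Finset.subset_union_left, fun e => ?_⟩)
      have h1 : s ∈ Finset.univ \ c.visited := by simp [hsv]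
      rw [← e, Finset.mem_sdiff, hvis] at h1
      exact h1.2 (Finset.mem_union_right _ (List.mem_toFinset.2 (List.mem_of_mem_head? hus)))
    have hconf : ∀ ω ∈ A' ∩ H, config R (fun j n => X j n ω) (k + 1) = some (c.addPath u) := by
      rintro ω ⟨hω, n, hn⟩
      rw [config_succ_of_not_spans (hAc ω hω.1) hs, stage_eq_some_iff]
      exact ⟨n, hn.1, hn.2.1, congrArg c.addPath hn.2.2⟩
    have hrec := ih _ hlt (k + 1) (c.addPath u) hc' (A' ∩ H)
      ((ℱ.mono (Nat.le_succ k) _ hA').inter hH) hconf rfl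
    have hprob : μ.real (A' ∩ H) =
        μ.real A' * hitReal P (R ∪ c.visited) {l | loopErasure l = u} s := by
      rw [Measure.real, (hX.chain k).measure_hitsVia (hX.measurableSet_walk k) (ℱ.le k) hA'
        (fun ω hω => hω.2), ENNReal.toReal_mul]
      rfl
    -- Generating `f` forces this stage to produce `u`, so the event `H` can be inserted for free.
    have hgen : A ∩ {ω | Generates R (fun k n => X k n ω) f} ∩ {ω | X k 0 ω = s} =
        A' ∩ H ∩ {ω | Generates R (fun k n => X k n ω) f} := by
      ext ω
      constructor
      · rintro ⟨⟨h1, h2⟩, h3⟩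
        exact ⟨⟨⟨h1, h3⟩, Generates.hitsVia hf h2 (hAc ω h1) hs hu cu
          (hus.trans (congrArg some h3.symm))⟩, h2⟩
      · rintro ⟨⟨⟨h1, h3⟩, -⟩, h2⟩
        exact ⟨⟨h1, h2⟩, h3⟩
    have hw : weight P (f.filter fun e => e.1 ∉ c.visited) =
        weight P (pathEdges u) * weight P (f.filter fun e => e.1 ∉ (c.addPath u).visited) := by
      rw [weight, weight, weight, ← Finset.prod_union]
      · congr 1
        ext e
        simp only [hvis, Finset.mem_union, Finset.mem_filter, List.mem_toFinset]
        have h1 := hmem e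
        have h2 := hsrc e
        have h3 := @hsub e
        simp only [Finset.mem_union] at h1
        tauto
      · refine Finset.disjoint_left.2 fun e he he' => (Finset.mem_filter.1 he').2 ?_
        exact Finset.mem_union_right _ (List.mem_toFinset.2 (fst_mem_of_mem_pathEdges he))
    have hT : R ∪ (c.addPath u).visited = R ∪ c.visited ∪ u.toFinset := by
      rw [hvis, Finset.union_assoc]
    have hq := det_absorb_mul_hitReal_loopErasure hP0 hP1 hu hn hus
    have hne := hdet (R ∪ c.visited ∪ u.toFinset)
      (Finset.subset_union_left.trans Finset.subset_union_left)
    rw [hT, hprob] at hrec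
    rw [hgen, hw]
    -- The minor on the complement of `R ∪ c.visited ∪ u` is the telescoping factor shared by this
    -- stage and the later ones.
    refine mul_left_cancel₀ hne ?_
    linear_combination (absorb P (R ∪ c.visited)).det * hrec +
      weight P (f.filter fun e => e.1 ∉ (c.addPath u).visited) * μ.real A' * hq
  have hfib : ∀ B : Set Ω, μ.real B = ∑ s, μ.real (B ∩ {ω | X k 0 ω = s}) := fun B => by
    simp only [Measure.real]
    rw [measure_eq_sum_fibers (hX.measurableSet_walk k 0) B,
      ENNReal.toReal_sum fun _ _ => measure_ne_top _ _]
  rw [hfib (A ∩ _), hfib A, Finset.mul_sum, Finset.mul_sum]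
  exact Finset.sum_congr rfl fun s _ => key s

theorem measure_generates (hX : IsWilsonInput P R μ ℱ X) [IsProbabilityMeasure μ]
    (hdet : ∀ T, R ⊆ T → (absorb P T).det ≠ 0) {f : Finset (S × S)} (hf : IsForest f)
    (hfR : roots f = R) :
    (absorb P R).det * μ.real {ω | Generates R (fun k n => X k n ω) f} = weight P f := by
  have h := hX.det_absorb_mul_measure_generates hP0 hP1 hdet hf hfR 0 ⟨∅, ∅⟩ (by simp) Set.univ
    MeasurableSet.univ fun _ _ => rfl
  simpa using h

end IsWilsonInput

end Wilson

theorem pos_of_weight_ne_zero {S : Type*} {P : Matrix S S ℝ}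
    (hP0 : ∀ i j, 0 ≤ P i j) {f : Finset (S × S)} (hf : weight P f ≠ 0) (i j : S)
    (h : (i, j) ∈ f) : 0 < P i j :=
  (hP0 i j).lt_of_ne' fun h0 => hf (Finset.prod_eq_zero h h0)

end WilsonForest

/-! ### The main theorem -/

theorem proposition5p1 {S : Type*} [Fintype S] [DecidableEq S]
    (P : Matrix S S ℝ) (hP0 : ∀ i j, 0 ≤ P i j) (hP1 : ∀ i, ∑ j, P i j = 1)
    (R : Finset S)
    {Ω : Type*} [mΩ : MeasurableSpace Ω] (μ : Measure Ω) [IsProbabilityMeasure μ]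
    (ℱ : Filtration ℕ mΩ) (X : ℕ → ℕ → Ω → S)
    (hX : WilsonForest.IsWilsonInput P R μ ℱ X) :
    ((∀ᵐ ω ∂μ, WilsonForest.Terminates R (fun k n => X k n ω)) ↔ 0 < WilsonForest.w P R) ∧
    (0 < WilsonForest.w P R →
      ∀ f : Finset (S × S), WilsonForest.IsForest f → WilsonForest.roots f = R →
        μ.real {ω | WilsonForest.Generates R (fun k n => X k n ω) f} =
          WilsonForest.weight P f / WilsonForest.w P R) := by
  classical
  open WilsonForest in
  have hforest : 0 < w P R → ∃ f, IsForest f ∧ roots f = R ∧ ∀ i j, (i, j) ∈ f → 0 < P i j := by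
    intro hw
    obtain ⟨f, hf, hfw⟩ := Finset.exists_ne_zero_of_sum_ne_zero hw.ne'
    simp only [Finset.mem_filter, Finset.mem_univ, true_and] at hf
    exact ⟨f, hf.1, hf.2, pos_of_weight_ne_zero hP0 hfw⟩
  have hterm : 0 < w P R → ∀ᵐ ω ∂μ, Terminates R (fun k n => X k n ω) := by
    intro hw
    obtain ⟨f, hf, hfR, hpos⟩ := hforest hw
    exact hX.ae_terminates hP0 hP1 hf hfR.subset hpos
  refine ⟨⟨fun h => ?_, hterm⟩, fun hw => ?_⟩
  -- A single good sample point suffices: its output is a forest of positive weight.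
  · obtain ⟨ω, hω, hstep⟩ := (h.and (ae_all_iff.2 fun k => (hX.chain k).ae_pos)).exists
    obtain ⟨f, hf, hfR, k, c, hc, -, rfl⟩ := hω.exists_generates
    refine Finset.sum_pos' (fun g _ => Finset.prod_nonneg fun e _ => hP0 _ _)
      ⟨c.edges, by simp [hf, hfR], Finset.prod_pos fun e he => ?_⟩
    exact rel_of_mem_edges (r := fun i j => 0 < P i j) hstep hc he
  · obtain ⟨f₀, hf₀, hf₀R, hpos⟩ := hforest hw
    have hdet : ∀ T, R ⊆ T → (absorb P T).det ≠ 0 := fun T hT =>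
      det_absorb_ne_zero hP0 hP1 hf₀ (hf₀R.subset.trans hT) hpos
    have hsum : ∑ f ∈ Finset.univ.filter (fun f : Finset (S × S) => IsForest f ∧ roots f = R),
        μ.real {ω | Generates R (fun k n => X k n ω) f} = 1 := by
      rw [← measureReal_biUnion_finset (f := fun f => {ω | Generates R (fun k n => X k n ω) f})
        (fun f _ g _ hfg => Set.disjoint_left.2 fun ω hf hg =>
          hfg (Generates.unique (x := fun k n => X k n ω) hf hg))
        fun f _ => hX.measurableSet_generates f, ← probReal_univ (μ := μ)]
      refine measureReal_congr ?_
      rw [Filter.eventuallyEq_univ]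
      filter_upwards [hterm hw] with ω hω
      obtain ⟨f, hf, hfR, hg⟩ := hω.exists_generates
      exact Set.mem_biUnion (by simp [hf, hfR]) hg
    -- Summing `measure_generates` over all forests with root set `R`, whose probabilities add up to
    -- one, identifies the normalizing constant.
    have hZ : (absorb P R).det = w P R := by
      rw [← mul_one (absorb P R).det, ← hsum, Finset.mul_sum, w]
      refine Finset.sum_congr (by congr) fun f hf => ?_
      simp only [Finset.mem_filter, Finset.mem_univ, true_and] at hf
      exact hX.measure_generates hP0 hP1 hdet hf.1 hf.2
    intro f hf hfR
    rw [eq_div_iff hw.ne', mul_comm, ← hZ]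
    exact hX.measure_generates hP0 hP1 hdet hf hfR
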